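/- Let $R$ be a commutative Noetherian local ring with maximal ideal $\mathfrak m$ and infinite residue field. For a finitely generated $R$-module $M$ put $\operatorname{grade} M=\inf\{i:\operatorname{Ext}^i_R(M,R)\neq 0\}$, and for an ideal $J\subseteq R$ put $\operatorname{grade} J=\operatorname{grade} R/J$ (so the unit ideal has grade $\infty$). An ideal $J$ of a Noetherian ring $S$ is called Gorenstein if, for some integer $c$, $\operatorname{grade} S/J=\operatorname{pd}_S S/J=c$ and $\operatorname{Ext}^c_S(S/J,S)\cong S/J$. An ideal $I\subseteq R$ is called generically Gorenstein if $I R_P$ is a Gorenstein ideal of $R_P$ for every associated prime $P$ of $R/I$. Let $p\ge 1$ and $q\ge 3$ be integers, let $I\subset R$ be an ideal of grade $3$, and let $$0\to A_3\xrightarrow{d_3}A_2\xrightarrow{d_2}A_1\xrightarrow{d_1}R,\qquad A_1=R^{p+2},\ A_2=R^{p+q},\ A_3=R^{q-1},$$ be a (not necessarily minimal) free resolution of $R/I$ (so $I$ is a perfect ideal of grade $3$). For a decomposition $A_3=C\oplus L$ with $C\cong R^{q-2}$ and $L\cong R$, let $J_C=I_{q-2}(d_3|_C)$ be the ideal generated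 by the $(q-2)\times(q-2)$ minors of $d_3|_C\colon C\to A_2$. 1. There is a choice of $C$ with $\operatorname{grade} J_C\ge 4$ if and only if $I$ is generically Gorenstein. 2. Suppose in addition that $I$ is not itself Gorenstein or that $\operatorname{depth} R=\operatorname{grade}\mathfrak m\ge 4$. Then there is a choice of $C$ with $\operatorname{grade} J_C=4$ if and only if $I$ is generically Gorenstein. -/

import Mathlib

universe u

open CategoryTheory

noncomputable section

/-- The grade of a module `M` over `R`: the least `i` with `Ext^i_R(M, R) ≠ 0`, and `⊤` if there is
no such `i`. -/
def moduleGrade (R : Type u) [CommRing R] (M : Type u) [AddCommGroup M] [Module R M] : ℕ∞ :=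
  ⨅ (i : ℕ) (_ : Nontrivial (Abelian.Ext (ModuleCat.of R M) (ModuleCat.of R R) i)), (i : ℕ∞)

/-- The grade of an ideal `I` is the grade of the module `R ⧸ I`; the unit ideal has grade `⊤`. -/
def idealGrade {R : Type u} [CommRing R] (I : Ideal R) : ℕ∞ :=
  moduleGrade R (R ⧸ I)

/-- `I` is a perfect ideal of grade `c`: the grade and the projective dimension of `R ⧸ I` are both
equal to the natural number `c` (so `I` is a proper ideal). -/
def IsPerfectOfGrade {R : Type u} [CommRing R] (I : Ideal R) (c : ℕ) : Prop :=
  idealGrade I = c ∧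
    projectiveDimension (ModuleCat.of R (R ⧸ I)) = ((c : ℕ∞) : WithBot ℕ∞)

/-- `I` is a Gorenstein ideal: it is perfect of some grade `c` and `Ext^c(R/I, R) ≅ R/I`. -/
def IsGorensteinIdeal {R : Type u} [CommRing R] (I : Ideal R) : Prop :=
  ∃ c : ℕ, IsPerfectOfGrade I c ∧
    Nonempty (Abelian.Ext (ModuleCat.of R (R ⧸ I)) (ModuleCat.of R R) c ≃ₗ[R] (R ⧸ I))

/-- `I` is generically Gorenstein: it becomes a Gorenstein ideal after localization at each
associated prime of `R ⧸ I`. (If `R` is Cohen–Macaulay and `I` is perfect, then `R ⧸ I` has no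
embedded primes and these are the minimal primes of `I`.) -/
def IsGenericallyGorenstein {R : Type u} [CommRing R] (I : Ideal R) : Prop :=
  ∀ (P : Ideal R) [P.IsPrime], P ∈ associatedPrimes R (R ⧸ I) →
    IsGorensteinIdeal (I.map (algebraMap R (Localization.AtPrime P)))

/-- The ideal `I_k(f)` of `k × k` minors of a linear map `f : M → N` of finite free modules, in
coordinate-free form: the image of the map `⋀^k M ⊗ ⋀^k N^* → R` induced by `f`. By
multilinearity it is generated by the `k × k` minors of the matrix of `f` in any pair of bases. -/
def minorIdeal {R : Type u} [CommRing R] {M N : Type u} [AddCommGroup M] [Module R M]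
    [AddCommGroup N] [Module R N] (k : ℕ) (f : M →ₗ[R] N) : Ideal R :=
  Ideal.span {r | ∃ (x : Fin k → M) (φ : Fin k → Module.Dual R N),
    r = (Matrix.of fun i j => φ i (f (x j))).det}

/-- `C` is the first summand of a decomposition `A = C ⊕ L` with `C ≅ R^k` and `L ≅ R`. -/
def IsCorankOneSummand {R : Type u} [CommRing R] {A : Type u} [AddCommGroup A] [Module R A]
    (k : ℕ) (C : Submodule R A) : Prop :=
  ∃ L : Submodule R A, IsCompl C L ∧ Nonempty (C ≃ₗ[R] (Fin k → R)) ∧ Nonempty (L ≃ₗ[R] R)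

/-- The complex `0 → A₃ → A₂ → A₁ → R` is a resolution of `R ⧸ I`. -/
structure IsResolutionOfQuotient {R : Type u} [CommRing R] {A₁ A₂ A₃ : Type u}
    [AddCommGroup A₁] [Module R A₁] [AddCommGroup A₂] [Module R A₂] [AddCommGroup A₃] [Module R A₃]
    (d₁ : A₁ →ₗ[R] R) (d₂ : A₂ →ₗ[R] A₁) (d₃ : A₃ →ₗ[R] A₂) (I : Ideal R) : Prop where
  range_d₁ : LinearMap.range d₁ = I
  exact_d₂_d₁ : Function.Exact d₂ d₁
  exact_d₃_d₂ : Function.Exact d₃ d₂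
  injective_d₃ : Function.Injective d₃

end

/-!
Put `ω = Ext³(R/I, R)`, which is presented by the dual of `d₃`. A hyperplane `C ⊆ A₃` is the kernel
of a surjective functional `x`, and Cramer's rule shows that the ideal of maximal minors of `d₃|_C`
has the same radical as the annihilator of the cokernel `ω/Rx` of the dual of `d₃|_C`; the grade of
a module only depends on its support, so the question is about the grade of `ω/Rx`.

The dual resolution gives `Ext³(ω, R) ≅ R/I`, hence `ann ω = I`. It follows that `ω/Rx` has grade at
least `4` iff `Hom(ω/Rx, R/I) = 0`, i.e. iff `x` generates `ω` at every associated prime of `R/I`.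
Such an `x` exists iff `I` is generically Gorenstein: over an infinite residue field a module is not
the union of finitely many proper submodules.

If the grade of `ω/Rx` is at least `5`, then `x` induces an embedding `R/I → ω`, and dualizing it
gives a surjection `R/I ≅ Ext³(ω, R) → Ext³(R/I, R) ≅ ω` through which one sees that `ω = Rx`. Thus
the grade is exactly `4` unless `I` is Gorenstein. If `ω = Rg` and `𝔪` has grade at least `4`, then
`𝔪` contains a nonzerodivisor `r` on `R/I`, and `ω/Rrg` has grade `4`; adding a relation of `ω` that
is not divisible by `𝔪` turns a lift of `rg` into a surjective functional.
-/

/-- `Ext^i_R(M, N)` for modules `M`, `N` in the universe of `R`. -/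
abbrev ModuleExt (R : Type u) [CommRing R] (M N : Type u) [AddCommGroup M] [Module R M]
    [AddCommGroup N] [Module R N] (i : ℕ) : Type u :=
  Abelian.Ext (ModuleCat.of R M) (ModuleCat.of R N) i

namespace ModuleExt

variable {R : Type u} [CommRing R] {A B C M N : Type u} [AddCommGroup A] [Module R A]
  [AddCommGroup B] [Module R B] [AddCommGroup C] [Module R C]
  [AddCommGroup M] [Module R M] [AddCommGroup N] [Module R N]

/-- The identification of `Ext^0` with `Hom`. -/
noncomputable def zeroEquiv : ModuleExt R M N 0 ≃ₗ[R] (M →ₗ[R] N) :=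
  Abelian.Ext.linearEquiv₀.trans ModuleCat.homLinearEquiv

/-- The map `Ext^i(B, N) → Ext^i(A, N)` induced by `f : A → B`. -/
noncomputable def precomp (f : A →ₗ[R] B) (N : Type u) [AddCommGroup N] [Module R N] (i : ℕ) :
    ModuleExt R B N i →ₗ[R] ModuleExt R A N i :=
  (Abelian.Ext.mk₀ (ModuleCat.ofHom f)).precompOfLinear R (ModuleCat.of R N) (zero_add i)

theorem precomp_apply (f : A →ₗ[R] B) {i : ℕ} (x : ModuleExt R B N i) :
    precomp f N i x = (Abelian.Ext.mk₀ (ModuleCat.ofHom f)).comp x (zero_add i) :=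
  rfl

theorem precomp_comp_apply (f : A →ₗ[R] B) (g : B →ₗ[R] C) {i : ℕ} (x : ModuleExt R C N i) :
    precomp (g ∘ₗ f) N i x = precomp f N i (precomp g N i x) := by
  simp only [precomp_apply, ModuleCat.ofHom_comp, Abelian.Ext.mk₀_comp_mk₀_assoc]

theorem precomp_smul_id_apply (r : R) {i : ℕ} (x : ModuleExt R A N i) :
    precomp (r • LinearMap.id) N i x = r • x := by
  have hr : ModuleCat.ofHom (r • LinearMap.id) = r • 𝟙 (ModuleCat.of R A) := rfl
  rw [precomp_apply, hr, Abelian.Ext.mk₀_smul, Abelian.Ext.smul_comp, Abelian.Ext.mk₀_id_comp]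

theorem zeroEquiv_symm_comp (f : A →ₗ[R] B) (φ : B →ₗ[R] N) :
    zeroEquiv.symm (φ ∘ₗ f) = precomp f N 0 (zeroEquiv.symm φ) :=
  (Abelian.Ext.mk₀_comp_mk₀ (ModuleCat.ofHom f) (ModuleCat.ofHom φ)).symm

theorem smul_eq_zero_of_mem_annihilator {r : R} (hr : r ∈ Module.annihilator R M) {i : ℕ}
    (x : ModuleExt R M N i) : r • x = 0 := by
  have hr_id : r • LinearMap.id = (0 : M →ₗ[R] M) := by
    ext m
    exact Module.mem_annihilator.1 hr m
  rw [← precomp_smul_id_apply, hr_id, precomp_apply, ModuleCat.ofHom_zero, Abelian.Ext.mk₀_zero,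
    Abelian.Ext.zero_comp]

theorem subsingleton_of_subsingleton [Subsingleton M] (i : ℕ) :
    Subsingleton (ModuleExt R M N i) :=
  subsingleton_of_forall_eq 0 fun x ↦ by
    rw [← one_smul R x]
    exact smul_eq_zero_of_mem_annihilator (by simp [Module.annihilator_eq_top_iff.2 ‹_›]) x

section ShortExact

variable {f : B →ₗ[R] A} {g : A →ₗ[R] C}

theorem shortExact_of_exact (hf : Function.Injective f) (hfg : Function.Exact f g)
    (hg : Function.Surjective g) :
    (ModuleCat.shortComplexOfCompEqZero f g hfg.linearMap_comp_eq_zero).ShortExact :=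
  ModuleCat.shortComplex_shortExact _ hfg hf hg

theorem precomp_surjective (hf : Function.Injective f) (hfg : Function.Exact f g)
    (hg : Function.Surjective g) {i : ℕ} (hC : Subsingleton (ModuleExt R C N (i + 1))) :
    Function.Surjective (precomp f N i) := fun x ↦
  Abelian.Ext.contravariant_sequence_exact₁ (shortExact_of_exact hf hfg hg) _ x (add_comm 1 i)
    (hC.elim _ _)

theorem precomp_injective (hf : Function.Injective f) (hfg : Function.Exact f g)
    (hg : Function.Surjective g) {i : ℕ} (hB : ∀ k < i, Subsingleton (ModuleExt R B N k)) :
    Function.Injective (precomp g N i) := by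
  cases i with
  | zero =>
    have h_square (x : ModuleExt R C N 0) : zeroEquiv x ∘ₗ g = zeroEquiv (precomp g N 0 x) := by
      rw [← LinearEquiv.symm_apply_eq, zeroEquiv_symm_comp, LinearEquiv.symm_apply_apply]
    exact fun x y hxy ↦ zeroEquiv.injective <| (LinearMap.cancel_right hg).1 <| by
      rw [h_square, h_square, hxy]
  | succ i =>
    rw [← LinearMap.ker_eq_bot, LinearMap.ker_eq_bot']
    intro x hx
    obtain ⟨y, rfl⟩ := Abelian.Ext.contravariant_sequence_exact₃ (shortExact_of_exact hf hfg hg) _ x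
      hx (add_comm 1 i)
    rw [(hB i i.lt_succ_self).elim y 0, Abelian.Ext.comp_zero]

theorem subsingleton_of_exact_right (hf : Function.Injective f) (hfg : Function.Exact f g)
    (hg : Function.Surjective g) {i : ℕ} (hA : Subsingleton (ModuleExt R M A i))
    (hB : Subsingleton (ModuleExt R M B (i + 1))) : Subsingleton (ModuleExt R M C i) :=
  subsingleton_of_forall_eq 0 fun x ↦ by
    obtain ⟨y, rfl⟩ := Abelian.Ext.covariant_sequence_exact₃ _ (shortExact_of_exact hf hfg hg) x
      rfl (hB.elim _ _)
    rw [hA.elim y 0, Abelian.Ext.zero_comp]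

end ShortExact

section FiniteProjectiveDimension

theorem subsingleton_of_retract {i : ℕ} (s : A →ₗ[R] B) (r : B →ₗ[R] A)
    (hrs : r ∘ₗ s = LinearMap.id) (hB : Subsingleton (ModuleExt R M B i)) :
    Subsingleton (ModuleExt R M A i) :=
  subsingleton_of_forall_eq 0 fun x ↦ by
    rw [← Abelian.Ext.comp_mk₀_id x, ← ModuleCat.ofHom_id, ← hrs, ModuleCat.ofHom_comp,
      ← Abelian.Ext.mk₀_comp_mk₀, ← Abelian.Ext.comp_assoc_of_third_deg_zero,
      hB.elim (x.comp _ _) 0, Abelian.Ext.zero_comp]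

theorem subsingleton_pi {n i : ℕ} (h : Subsingleton (ModuleExt R M N i)) :
    Subsingleton (ModuleExt R M (Fin n → N) i) := by
  let e := (ModuleCat.biproductIsoPi fun _ : Fin n ↦ ModuleCat.of R N).toLinearEquiv
  have h_biproduct := (Abelian.Ext.addEquivBiproduct (ModuleCat.of R M)
    (Limits.biproduct.isBilimit fun _ : Fin n ↦ ModuleCat.of R N) i).toEquiv.subsingleton
  exact subsingleton_of_retract e.symm.toLinearMap e.toLinearMap e.comp_symm h_biproduct

theorem subsingleton_of_projective [Module.Finite R A] [Module.Projective R A] {i : ℕ}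
    (h : Subsingleton (ModuleExt R M R i)) : Subsingleton (ModuleExt R M A i) := by
  obtain ⟨n, r, s, -, -, hrs⟩ := Module.Finite.exists_comp_eq_id_of_projective R A
  exact subsingleton_of_retract s r hrs (subsingleton_pi h)

theorem subsingleton_of_hasProjectiveDimensionLT [IsNoetherianRing R] [Module.Finite R N]
    {n j : ℕ} (hN : HasProjectiveDimensionLT (ModuleCat.of R N) (n + 1))
    (h : ∀ i ≤ n + j, Subsingleton (ModuleExt R M R i)) : Subsingleton (ModuleExt R M N j) := by
  induction n generalizing j N with
  | zero =>
    have h_projective : Module.Projective R N := by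
      rwa [IsProjective.iff_projective, projective_iff_hasProjectiveDimensionLT_one]
    exact subsingleton_of_projective (h j (by simp))
  | succ n ih =>
    obtain ⟨F, _, _, _, _, g, hg⟩ := Module.exists_finite_presentation R N
    have hS := shortExact_of_exact (LinearMap.ker g).injective_subtype g.exact_subtype_ker_map hg
    have hF : Projective (ModuleCat.of R F) := ModuleCat.projective_of_categoryTheory_projective _
    exact subsingleton_of_exact_right (LinearMap.ker g).injective_subtype g.exact_subtype_ker_map hg
      (subsingleton_of_projective (h j (by omega)))
      (ih ((hS.hasProjectiveDimensionLT_X₃_iff n hF).1 hN) fun i hi ↦ h i (by omega))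

end FiniteProjectiveDimension

section Syzygy

variable {f : B →ₗ[R] A} {g : A →ₗ[R] C}

theorem nonempty_shift_equiv [Module.Projective R A] (hf : Function.Injective f)
    (hfg : Function.Exact f g) (hg : Function.Surjective g) (i : ℕ) :
    Nonempty (ModuleExt R B N (i + 1) ≃ₗ[R] ModuleExt R C N (i + 2)) := by
  have hS := shortExact_of_exact hf hfg hg
  have hA : Projective (ModuleCat.of R A) := ModuleCat.projective_of_categoryTheory_projective _
  refine ⟨LinearEquiv.ofBijective
    (hS.extClass.precompOfLinear R (ModuleCat.of R N) (a := i + 1) (b := i + 2) (by omega))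
    ⟨?_, precomp_extClass_surjective_of_projective_X₂ _ hS _⟩⟩
  rw [← LinearMap.ker_eq_bot, LinearMap.ker_eq_bot']
  intro x hx
  obtain ⟨y, rfl⟩ := Abelian.Ext.contravariant_sequence_exact₁ hS _ x (by omega) hx
  rw [Abelian.Ext.eq_zero_of_projective y, Abelian.Ext.comp_zero]

theorem exists_connecting_zero [Module.Projective R A] (hf : Function.Injective f)
    (hfg : Function.Exact f g) (hg : Function.Surjective g) (N : Type u) [AddCommGroup N]
    [Module R N] :
    ∃ δ : (B →ₗ[R] N) →ₗ[R] ModuleExt R C N 1, Function.Surjective δ ∧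
      Function.Exact (LinearMap.lcomp R N f) δ := by
  have hS := shortExact_of_exact hf hfg hg
  have hA : Projective (ModuleCat.of R A) := ModuleCat.projective_of_categoryTheory_projective _
  refine ⟨(hS.extClass.precompOfLinear R (ModuleCat.of R N) (a := 0) (b := 1) rfl) ∘ₗ
    zeroEquiv.symm.toLinearMap,
    (precomp_extClass_surjective_of_projective_X₂ _ hS _).comp zeroEquiv.symm.surjective,
    fun φ ↦ ⟨fun hφ ↦ ?_, ?_⟩⟩
  · obtain ⟨y, hy⟩ := Abelian.Ext.contravariant_sequence_exact₁ hS _ _ (n₁ := 1) rfl hφ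
    refine ⟨zeroEquiv y, zeroEquiv.symm.injective ?_⟩
    rw [LinearMap.lcomp_apply', zeroEquiv_symm_comp, LinearEquiv.symm_apply_apply]
    exact hy
  · rintro ⟨ψ, rfl⟩
    change hS.extClass.comp (zeroEquiv.symm (ψ ∘ₗ f)) (rfl : 1 + 0 = 1) = 0
    rw [zeroEquiv_symm_comp]
    exact hS.extClass_comp_assoc _

end Syzygy

section Localization

variable [IsNoetherianRing R] (W : Submonoid R) {S : Type u} [CommRing S] [Algebra R S]
  [IsLocalization W S]

theorem nonempty_zero_equiv_of_isLocalizedModule [Module.Finite R M] {M' N' E : Type u}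
    [AddCommGroup M'] [Module R M'] [Module S M'] [IsScalarTower R S M']
    [AddCommGroup N'] [Module R N'] [Module S N'] [IsScalarTower R S N']
    [AddCommGroup E] [Module R E] [Module S E] [IsScalarTower R S E]
    (f : M →ₗ[R] M') [IsLocalizedModule W f] (g : N →ₗ[R] N') [IsLocalizedModule W g]
    (h : ModuleExt R M N 0 →ₗ[R] E) [IsLocalizedModule W h] :
    Nonempty (E ≃ₗ[S] ModuleExt S M' N' 0) := by
  have hM := Module.finitePresentation_of_finite R M
  exact ⟨(IsLocalizedModule.mapEquiv W h (IsLocalizedModule.mapExtendScalars W f g S) S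
    zeroEquiv).trans zeroEquiv.symm⟩

theorem nonempty_one_equiv_of_isLocalizedModule {A' B' C' N' E : Type u}
    [AddCommGroup A'] [Module R A'] [Module S A'] [IsScalarTower R S A']
    [AddCommGroup B'] [Module R B'] [Module S B'] [IsScalarTower R S B']
    [AddCommGroup C'] [Module R C'] [Module S C'] [IsScalarTower R S C']
    [AddCommGroup N'] [Module R N'] [Module S N'] [IsScalarTower R S N']
    [AddCommGroup E] [Module R E] [Module S E] [IsScalarTower R S E]
    [Module.Finite R A] [Module.Projective R A] [Module.Finite R B]
    {f : B →ₗ[R] A} {g : A →ₗ[R] C}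
    (hf : Function.Injective f) (hfg : Function.Exact f g) (hg : Function.Surjective g)
    (lA : A →ₗ[R] A') [IsLocalizedModule W lA] (lB : B →ₗ[R] B') [IsLocalizedModule W lB]
    (lC : C →ₗ[R] C') [IsLocalizedModule W lC] (lN : N →ₗ[R] N') [IsLocalizedModule W lN]
    (h : ModuleExt R C N 1 →ₗ[R] E) [IsLocalizedModule W h] :
    Nonempty (E ≃ₗ[S] ModuleExt S C' N' 1) := by
  have hA := Module.finitePresentation_of_finite R A
  have hB := Module.finitePresentation_of_finite R B
  have hA' : Module.Projective S A' := Module.projective_of_isLocalizedModule W lA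
  let homA := IsLocalizedModule.mapExtendScalars W lA lN S
  let homB := IsLocalizedModule.mapExtendScalars W lB lN S
  let f' := IsLocalizedModule.mapExtendScalars W lB lA S f
  let g' := IsLocalizedModule.mapExtendScalars W lA lC S g
  obtain ⟨δ, hδ_surj, hδ⟩ := exists_connecting_zero hf hfg hg N
  obtain ⟨δ', hδ'_surj, hδ'⟩ := exists_connecting_zero (f := f') (g := g')
    (IsLocalizedModule.map_injective W lB lA f hf) (IsLocalizedModule.map_exact W lB lA lC f g hfg)
    (IsLocalizedModule.map_surjective W lA lC g hg) N'
  have h_lcomp : IsLocalizedModule.map W homA homB (LinearMap.lcomp R N f) =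
      (LinearMap.lcomp S N' f').restrictScalars R := by
    refine IsLocalizedModule.linearMap_ext W homA homB (LinearMap.ext fun φ ↦ ?_)
    rw [LinearMap.comp_apply, IsLocalizedModule.map_apply]
    refine LinearMap.restrictScalars_injective R
      (IsLocalizedModule.linearMap_ext W lB lN (LinearMap.ext fun b ↦ ?_))
    simp [homA, homB, f']
  have hδ_loc := IsLocalizedModule.map_exact W homA homB h _ _ hδ
  rw [h_lcomp] at hδ_loc
  exact ⟨(Function.Exact.linearEquivOfSurjective (f := LinearMap.lcomp S N' f')
    (g := IsLocalizedModule.mapExtendScalars W homB h S δ) hδ_loc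
    (IsLocalizedModule.map_surjective W homB h δ hδ_surj)).symm.trans
    (hδ'.linearEquivOfSurjective hδ'_surj)⟩

theorem nonempty_equiv_of_isLocalizedModule [Module.Finite R M] {M' N' E : Type u}
    [AddCommGroup M'] [Module R M'] [Module S M'] [IsScalarTower R S M']
    [AddCommGroup N'] [Module R N'] [Module S N'] [IsScalarTower R S N']
    [AddCommGroup E] [Module R E] [Module S E] [IsScalarTower R S E]
    (f : M →ₗ[R] M') [IsLocalizedModule W f] (g : N →ₗ[R] N') [IsLocalizedModule W g] {i : ℕ}
    (h : ModuleExt R M N i →ₗ[R] E) [IsLocalizedModule W h] :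
    Nonempty (E ≃ₗ[S] ModuleExt S M' N' i) := by
  induction i generalizing M M' with
  | zero => exact nonempty_zero_equiv_of_isLocalizedModule W f g h
  | succ i ih =>
    obtain ⟨F, _, _, _, _, π, hπ⟩ := Module.exists_finite_presentation R M
    let lF := TensorProduct.mk R S F 1
    let lK := TensorProduct.mk R S (LinearMap.ker π) 1
    cases i with
    | zero =>
      exact nonempty_one_equiv_of_isLocalizedModule W (LinearMap.ker π).injective_subtype
        π.exact_subtype_ker_map hπ lF lK f g h
    | succ i =>
      have hF' : Module.Projective S (TensorProduct R S F) :=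
        Module.projective_of_isLocalizedModule W lF
      obtain ⟨shift⟩ := nonempty_shift_equiv (N := N) (LinearMap.ker π).injective_subtype
        π.exact_subtype_ker_map hπ i
      obtain ⟨shift'⟩ := nonempty_shift_equiv (N := N') (f := IsLocalizedModule.mapExtendScalars W
          lK lF S (LinearMap.ker π).subtype) (g := IsLocalizedModule.mapExtendScalars W lF f S π)
        (IsLocalizedModule.map_injective W lK lF _ (LinearMap.ker π).injective_subtype)
        (IsLocalizedModule.map_exact W lK lF f _ π π.exact_subtype_ker_map)
        (IsLocalizedModule.map_surjective W lF f π hπ) i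
      obtain ⟨e⟩ := ih lK (h ∘ₗ shift.toLinearMap)
      exact ⟨e.trans shift'⟩

end Localization

theorem exact_lcomp_of_subsingleton_one [Module.Projective R A] {D : Type u} [AddCommGroup D]
    [Module R D] {e : D →ₗ[R] B} {f : B →ₗ[R] A} {g : A →ₗ[R] C} (hef : Function.Exact e f)
    (hfg : Function.Exact f g) (hg : Function.Surjective g)
    (hC : Subsingleton (ModuleExt R C N 1)) :
    Function.Exact (LinearMap.lcomp R N f) (LinearMap.lcomp R N e) := by
  obtain ⟨δ, -, hδ⟩ := exists_connecting_zero (LinearMap.range f).injective_subtype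
    (f.surjective_rangeRestrict.comp_exact_iff_exact.1 hfg) hg N
  have h_ext : Function.Surjective (LinearMap.lcomp R N (LinearMap.range f).subtype) :=
    fun φ ↦ (hδ φ).1 (hC.elim _ _)
  have hef_range : Function.Exact e f.rangeRestrict :=
    (LinearMap.range f).injective_subtype.comp_exact_iff_exact.1 hef
  exact h_ext.comp_exact_iff_exact.2 <|
    LinearMap.exact_lcomp_of_exact_of_surjective N hef_range f.surjective_rangeRestrict

end ModuleExt

/-- The sequence `0 → A₃ → A₂ → A₁ → A₀ → M → 0` with maps `d₃`, `d₂`, `d₁`, `ε` is exact. The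
modules `Aᵢ` are typically projective, but this is not part of the definition. -/
structure IsResolutionOfLengthThree {R : Type*} [CommRing R] {A₀ A₁ A₂ A₃ M : Type*}
    [AddCommGroup A₀] [Module R A₀] [AddCommGroup A₁] [Module R A₁] [AddCommGroup A₂] [Module R A₂]
    [AddCommGroup A₃] [Module R A₃] [AddCommGroup M] [Module R M]
    (d₃ : A₃ →ₗ[R] A₂) (d₂ : A₂ →ₗ[R] A₁) (d₁ : A₁ →ₗ[R] A₀) (ε : A₀ →ₗ[R] M) : Prop where
  injective : Function.Injective d₃
  exact₂ : Function.Exact d₃ d₂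
  exact₁ : Function.Exact d₂ d₁
  exact₀ : Function.Exact d₁ ε
  surjective : Function.Surjective ε

namespace IsResolutionOfLengthThree

open ModuleExt

variable {R : Type u} [CommRing R] {A₀ A₁ A₂ A₃ M : Type u}
  [AddCommGroup A₀] [Module R A₀] [AddCommGroup A₁] [Module R A₁] [AddCommGroup A₂] [Module R A₂]
  [AddCommGroup A₃] [Module R A₃] [AddCommGroup M] [Module R M]
  {d₃ : A₃ →ₗ[R] A₂} {d₂ : A₂ →ₗ[R] A₁} {d₁ : A₁ →ₗ[R] A₀} {ε : A₀ →ₗ[R] M}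

theorem exact_subtype (h : IsResolutionOfLengthThree d₃ d₂ d₁ ε) :
    Function.Exact (LinearMap.range d₁).subtype ε :=
  d₁.surjective_rangeRestrict.comp_exact_iff_exact.1 h.exact₀

theorem exact_subtype_rangeRestrict (h : IsResolutionOfLengthThree d₃ d₂ d₁ ε) :
    Function.Exact (LinearMap.range d₂).subtype d₁.rangeRestrict :=
  h.exact₁.linearMap_rangeRestrict

theorem exact_rangeRestrict (h : IsResolutionOfLengthThree d₃ d₂ d₁ ε) :
    Function.Exact d₃ d₂.rangeRestrict :=
  (LinearMap.range d₂).injective_subtype.comp_exact_iff_exact.1 h.exact₂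

theorem hasProjectiveDimensionLT [Module.Projective R A₀] [Module.Projective R A₁]
    [Module.Projective R A₂] [Module.Projective R A₃] (h : IsResolutionOfLengthThree d₃ d₂ d₁ ε) :
    HasProjectiveDimensionLT (ModuleCat.of R M) 4 := by
  have h_proj (A : Type u) [AddCommGroup A] [Module R A] [Module.Projective R A] :
      Projective (ModuleCat.of R A) := ModuleCat.projective_of_categoryTheory_projective _
  have h₀ := shortExact_of_exact (LinearMap.range d₁).injective_subtype h.exact_subtype h.surjective
  have h₁ := shortExact_of_exact (LinearMap.range d₂).injective_subtype
    h.exact_subtype_rangeRestrict d₁.surjective_rangeRestrict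
  have h₂ := shortExact_of_exact h.injective h.exact_rangeRestrict d₂.surjective_rangeRestrict
  exact (h₀.hasProjectiveDimensionLT_X₃_iff 2 (h_proj A₀)).2 <|
    (h₁.hasProjectiveDimensionLT_X₃_iff 1 (h_proj A₁)).2 <|
    (h₂.hasProjectiveDimensionLT_X₃_iff 0 (h_proj A₂)).2 <|
    projective_iff_hasProjectiveDimensionLT_one.1 (h_proj A₃)

theorem nonempty_equiv_of_exact {M' : Type u} [AddCommGroup M'] [Module R M'] {ε' : A₀ →ₗ[R] M'}
    (h : IsResolutionOfLengthThree d₃ d₂ d₁ ε) (hε' : Function.Exact d₁ ε')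
    (hε'_surj : Function.Surjective ε') : Nonempty (M' ≃ₗ[R] M) :=
  ⟨(hε'.linearEquivOfSurjective hε'_surj).symm.trans
    (h.exact₀.linearEquivOfSurjective h.surjective)⟩

variable [Module.Projective R A₀] [Module.Projective R A₁] [Module.Projective R A₂]

theorem exists_ext_three (h : IsResolutionOfLengthThree d₃ d₂ d₁ ε) (N : Type u) [AddCommGroup N]
    [Module R N] :
    ∃ δ : (A₃ →ₗ[R] N) →ₗ[R] ModuleExt R M N 3, Function.Surjective δ ∧
      Function.Exact (LinearMap.lcomp R N d₃) δ := by
  obtain ⟨e⟩ := nonempty_shift_equiv (N := N) (LinearMap.range d₁).injective_subtype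
    h.exact_subtype h.surjective 1
  obtain ⟨e'⟩ := nonempty_shift_equiv (N := N) (LinearMap.range d₂).injective_subtype
    h.exact_subtype_rangeRestrict d₁.surjective_rangeRestrict 0
  obtain ⟨δ, hδ_surj, hδ⟩ := exists_connecting_zero h.injective h.exact_rangeRestrict
    d₂.surjective_rangeRestrict N
  exact ⟨(e'.trans e).toLinearMap ∘ₗ δ, (e'.trans e).surjective.comp hδ_surj,
    (e'.trans e).injective.comp_exact_iff_exact.2 hδ⟩

theorem exists_hom_resolution (h : IsResolutionOfLengthThree d₃ d₂ d₁ ε) (N : Type u)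
    [AddCommGroup N] [Module R N] (h_ext : ∀ i < 3, Subsingleton (ModuleExt R M N i)) :
    ∃ δ : (A₃ →ₗ[R] N) →ₗ[R] ModuleExt R M N 3,
      IsResolutionOfLengthThree (LinearMap.lcomp R N d₁) (LinearMap.lcomp R N d₂)
        (LinearMap.lcomp R N d₃) δ := by
  obtain ⟨δ, hδ_surj, hδ⟩ := h.exists_ext_three N
  obtain ⟨e⟩ := nonempty_shift_equiv (N := N) (LinearMap.range d₁).injective_subtype
    h.exact_subtype h.surjective 0
  have h_range : Subsingleton (ModuleExt R (LinearMap.range d₁) N 1) :=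
    e.toEquiv.subsingleton_congr.2 (h_ext 2 (by omega))
  have h_hom : Subsingleton (M →ₗ[R] N) :=
    zeroEquiv.toEquiv.subsingleton_congr.1 (h_ext 0 (by omega))
  refine ⟨δ, ?_, exact_lcomp_of_subsingleton_one h.exact₁ h.exact₀ h.surjective
    (h_ext 1 (by omega)), ?_, hδ, hδ_surj⟩
  · refine (injective_iff_map_eq_zero _).2 fun φ hφ ↦ ?_
    obtain ⟨ψ, rfl⟩ :=
      (LinearMap.exact_lcomp_of_exact_of_surjective N h.exact₀ h.surjective φ).1 hφ
    rw [h_hom.elim ψ 0, map_zero]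
  · exact exact_lcomp_of_subsingleton_one (g := d₁.rangeRestrict) h.exact₂
      ((LinearMap.range d₁).injective_subtype.comp_exact_iff_exact.1 h.exact₁)
      d₁.surjective_rangeRestrict h_range

theorem nonempty_ext_ext_equiv [Module.Finite R A₀] [Module.Finite R A₁] [Module.Finite R A₂]
    [Module.Finite R A₃] [Module.Projective R A₃] (h : IsResolutionOfLengthThree d₃ d₂ d₁ ε)
    (h_ext : ∀ i < 3, Subsingleton (ModuleExt R M R i)) :
    Nonempty (ModuleExt R (ModuleExt R M R 3) R 3 ≃ₗ[R] M) := by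
  obtain ⟨δ, hδ⟩ := h.exists_hom_resolution R h_ext
  obtain ⟨δ', hδ'_surj, hδ'⟩ := hδ.exists_ext_three R
  refine h.nonempty_equiv_of_exact (ε' := δ' ∘ₗ (Module.evalEquiv R A₀).toLinearMap) ?_
    (hδ'_surj.comp (Module.evalEquiv R A₀).surjective)
  refine (Function.Exact.iff_of_ladder_linearEquiv (e₁ := Module.evalEquiv R A₁)
    (e₂ := Module.evalEquiv R A₀) (e₃ := LinearEquiv.refl R _) ?_ ?_).1 hδ'
  · ext; rfl
  · ext; rfl

end IsResolutionOfLengthThree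

section Grade

variable {R : Type u} [CommRing R] {M N : Type u} [AddCommGroup M] [Module R M]
  [AddCommGroup N] [Module R N]

theorem le_moduleGrade_iff (n : ℕ) :
    (n : ℕ∞) ≤ moduleGrade R M ↔ ∀ i < n, Subsingleton (ModuleExt R M R i) := by
  simp only [moduleGrade, le_iInf_iff, Nat.cast_le]
  refine forall_congr' fun i ↦ ?_
  rw [← not_nontrivial_iff_subsingleton, ← not_lt]
  exact ⟨fun h hi hn ↦ h hn hi, fun h hn hi ↦ h hi hn⟩

theorem moduleGrade_eq_of_nontrivial {n : ℕ} (h : ∀ i < n, Subsingleton (ModuleExt R M R i))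
    (hn : Nontrivial (ModuleExt R M R n)) : moduleGrade R M = n :=
  le_antisymm (iInf₂_le n hn) ((le_moduleGrade_iff n).2 h)

variable [IsNoetherianRing R] [Module.Finite R M] [Module.Finite R N]

theorem moduleGrade_le_of_support_subset (h : Module.support R N ⊆ Module.support R M) :
    moduleGrade R M ≤ moduleGrade R N := by
  refine ENat.forall_natCast_le_iff_le.1 fun n hn ↦ (le_moduleGrade_iff n).2 ?_
  have h_supp : Module.support R M = PrimeSpectrum.zeroLocus (Module.annihilator R M) :=
    Module.support_eq_zeroLocus
  rcases eq_or_ne (Module.annihilator R M) ⊤ with h_top | h_top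
  · rw [Module.annihilator_eq_top_iff, ← Module.support_eq_empty_iff (R := R)] at h_top
    have : Subsingleton N :=
      (Module.support_eq_empty_iff (R := R)).1 (Set.subset_eq_empty h h_top)
    exact fun i _ ↦ ModuleExt.subsingleton_of_subsingleton i
  · have h_lt : Module.annihilator R M • (⊤ : Submodule R R) < ⊤ := by
      simpa [lt_top_iff_ne_top] using h_top
    obtain ⟨rs, rfl, h_mem, h_reg⟩ := ModuleCat.exists_isRegular_of_exists_subsingleton_ext
      (Module.annihilator R M) n (ModuleCat.of R R) h_lt (ModuleCat.of R M) h_supp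
      ((le_moduleGrade_iff n).1 hn)
    exact ModuleCat.subsingleton_ext_of_exists_isRegular (Module.annihilator R M)
      (ModuleCat.of R N) (h.trans_eq h_supp) (ModuleCat.of R R) h_lt rs h_mem h_reg

theorem moduleGrade_eq_of_support_eq (h : Module.support R M = Module.support R N) :
    moduleGrade R M = moduleGrade R N :=
  le_antisymm (moduleGrade_le_of_support_subset h.symm.subset)
    (moduleGrade_le_of_support_subset h.subset)

end Grade

theorem hasProjectiveDimensionLE_of_isLocalizedModule {R : Type u} [CommRing R] (W : Submonoid R)
    {M M' : Type u} [AddCommGroup M] [Module R M] [AddCommGroup M'] [Module R M']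
    [Module (Localization W) M'] [IsScalarTower R (Localization W) M'] (f : M →ₗ[R] M')
    [IsLocalizedModule W f] (n : ℕ) [HasProjectiveDimensionLE (ModuleCat.of R M) n] :
    HasProjectiveDimensionLE (ModuleCat.of (Localization W) M') n := by
  have := ModuleCat.localizedModule_hasProjectiveDimensionLE n W (ModuleCat.of R M)
  let e : Shrink.{u} (LocalizedModule W M) ≃ₗ[Localization W] M' :=
    (Shrink.linearEquiv (Localization W) (LocalizedModule W M)).trans <|
      LinearEquiv.extendScalarsOfIsLocalization W (Localization W) (IsLocalizedModule.iso W f)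
  exact ModuleCat.hasProjectiveDimensionLE_of_linearEquiv
    (M := (ModuleCat.of R M).localizedModule W) (N := ModuleCat.of (Localization W) M') e n

theorem ModuleExt.annihilator_le {R : Type u} [CommRing R] {M N : Type u} [AddCommGroup M]
    [Module R M] [AddCommGroup N] [Module R N] (i : ℕ) :
    Module.annihilator R M ≤ Module.annihilator R (ModuleExt R M N i) :=
  fun _ hr ↦ Module.mem_annihilator.2 (smul_eq_zero_of_mem_annihilator hr)

theorem subsingleton_linearMap_iff_forall_notMem_support {R : Type*} [CommRing R]
    [IsNoetherianRing R] {M N : Type*} [AddCommGroup M] [Module R M] [AddCommGroup N] [Module R N]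
    [Module.Finite R M] [Module.Finite R N] :
    Subsingleton (N →ₗ[R] M) ↔ ∀ P : PrimeSpectrum R, P.asIdeal ∈ associatedPrimes R M →
      P ∉ Module.support R N := by
  rw [IsSMulRegular.subsingleton_linearMap_iff]
  simp only [Module.mem_support_iff_of_finite]
  constructor
  · rintro ⟨r, hr, hr_reg⟩ P hP hle
    have : r ∈ ⋃ P ∈ associatedPrimes R M, (P : Set R) := Set.mem_biUnion hP (hle hr)
    rw [biUnion_associatedPrimes_eq_compl_regular] at this
    exact this hr_reg
  · intro h
    by_contra! h_reg
    have h_subset : (Module.annihilator R N : Set R) ⊆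
        ⋃ P ∈ associatedPrimes R M, ((id P : Ideal R) : Set R) := by
      simp only [id, biUnion_associatedPrimes_eq_compl_regular]
      exact h_reg
    obtain ⟨P, hP, hle⟩ := (Ideal.subset_union_prime_finite (associatedPrimes.finite R M) ⊥ ⊥
      fun P hP _ _ ↦ hP.1).1 h_subset
    exact h ⟨P, hP.1⟩ hP hle

theorem span_singleton_localized_eq_top_iff {R : Type*} [CommRing R] (W : Submonoid R)
    {M : Type*} [AddCommGroup M] [Module R M] {S M' : Type*} [CommRing S] [Algebra R S]
    [IsLocalization W S] [AddCommGroup M'] [Module R M'] [Module S M'] [IsScalarTower R S M']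
    (f : M →ₗ[R] M') [IsLocalizedModule W f] (x : M) :
    Submodule.span S {f x} = ⊤ ↔ ∀ y : M, ∃ w ∈ W, w • y ∈ Submodule.span R {x} := by
  rw [Submodule.eq_top_iff']
  simp only [Submodule.mem_span_singleton]
  constructor
  · intro h y
    obtain ⟨s, hs⟩ := h (f y)
    obtain ⟨r, w, rfl⟩ := IsLocalization.exists_mk'_eq W s
    have h_eq : f (r • x) = f ((w : R) • y) := by
      rw [map_smul, map_smul, ← hs, ← algebraMap_smul S (w : R), smul_smul,
        IsLocalization.mk'_spec', algebraMap_smul]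
    obtain ⟨w', hw'⟩ := (IsLocalizedModule.eq_iff_exists W f).1 h_eq
    exact ⟨w' * w, (w' * w).2, w' * r, by simpa [Submonoid.smul_def, mul_smul] using hw'⟩
  · intro h y'
    obtain ⟨⟨y, w⟩, rfl⟩ := IsLocalizedModule.mk'_surjective W f y'
    obtain ⟨w', hw', r, hr⟩ := h y
    refine ⟨IsLocalization.mk' S r (⟨w', hw'⟩ * w), ?_⟩
    rw [← IsLocalizedModule.mk'_one W f x, IsLocalizedModule.mk'_smul_mk', hr, mul_one]
    exact IsLocalizedModule.mk'_cancel_left f y ⟨w', hw'⟩ w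

theorem notMem_support_quotient_iff {R : Type*} [CommRing R] {M : Type*} [AddCommGroup M]
    [Module R M] {N : Submodule R M} {P : PrimeSpectrum R} :
    P ∉ Module.support R (M ⧸ N) ↔ ∀ y : M, ∃ r ∉ P.asIdeal, r • y ∈ N := by
  simp only [Module.notMem_support_iff', N.mkQ_surjective.forall, Submodule.mkQ_apply,
    ← Submodule.Quotient.mk_smul, Submodule.Quotient.mk_eq_zero]

theorem span_singleton_map_one_eq_top {R : Type*} [CommRing R] {I : Ideal R} {M : Type*}
    [AddCommGroup M] [Module R M] (φ : (R ⧸ I) →ₗ[R] M) (hφ : Function.Surjective φ) :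
    Submodule.span R {φ 1} = ⊤ := by
  refine Submodule.eq_top_iff'.2 fun y ↦ Submodule.mem_span_singleton.2 ?_
  obtain ⟨a, rfl⟩ := hφ y
  obtain ⟨r, rfl⟩ := Ideal.Quotient.mk_surjective a
  exact ⟨r, by rw [← map_smul, Algebra.smul_def, mul_one]; rfl⟩

/-- `ω` is the canonical module `Ext^c(R/I, R)` of an ideal `I` such that `R/I` has projective
dimension at most `c` and grade at least `c`, and duality holds: `Ext^c(ω, R) ≅ R/I`. The unit ideal
is allowed, with `ω = 0`. -/
structure IsCanonicalModule {R : Type u} [CommRing R] (I : Ideal R) (c : ℕ) (ω : Type u)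
    [AddCommGroup ω] [Module R ω] : Prop where
  hasProjectiveDimensionLE : HasProjectiveDimensionLE (ModuleCat.of R (R ⧸ I)) c
  subsingleton_ext_quotient : ∀ i < c, Subsingleton (ModuleExt R (R ⧸ I) R i)
  nonempty_ext_quotient_equiv : Nonempty (ModuleExt R (R ⧸ I) R c ≃ₗ[R] ω)
  nonempty_ext_equiv : Nonempty (ModuleExt R ω R c ≃ₗ[R] R ⧸ I)

theorem IsResolutionOfLengthThree.isCanonicalModule {R : Type u} [CommRing R] {I : Ideal R}
    {A₀ A₁ A₂ A₃ : Type u} [AddCommGroup A₀] [Module R A₀] [AddCommGroup A₁] [Module R A₁]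
    [AddCommGroup A₂] [Module R A₂] [AddCommGroup A₃] [Module R A₃] [Module.Finite R A₀]
    [Module.Projective R A₀] [Module.Finite R A₁] [Module.Projective R A₁] [Module.Finite R A₂]
    [Module.Projective R A₂] [Module.Finite R A₃] [Module.Projective R A₃] {d₃ : A₃ →ₗ[R] A₂}
    {d₂ : A₂ →ₗ[R] A₁} {d₁ : A₁ →ₗ[R] A₀} {ε : A₀ →ₗ[R] R ⧸ I}
    (h : IsResolutionOfLengthThree d₃ d₂ d₁ ε) (hI : 3 ≤ idealGrade I) :
    IsCanonicalModule I 3 (ModuleExt R (R ⧸ I) R 3) where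
  hasProjectiveDimensionLE := h.hasProjectiveDimensionLT
  subsingleton_ext_quotient := (le_moduleGrade_iff 3).1 hI
  nonempty_ext_quotient_equiv := ⟨LinearEquiv.refl R _⟩
  nonempty_ext_equiv := h.nonempty_ext_ext_equiv ((le_moduleGrade_iff 3).1 hI)

namespace IsCanonicalModule

open ModuleExt Submodule

variable {R : Type u} [CommRing R] {I : Ideal R} {c : ℕ} {ω : Type u} [AddCommGroup ω] [Module R ω]

theorem annihilator_eq (h : IsCanonicalModule I c ω) : Module.annihilator R ω = I := by
  obtain ⟨e⟩ := h.nonempty_ext_quotient_equiv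
  obtain ⟨e'⟩ := h.nonempty_ext_equiv
  refine le_antisymm ?_ ?_
  · simpa only [e'.annihilator_eq, Ideal.annihilator_quotient] using
      annihilator_le (R := R) (M := ω) (N := R) c
  · simpa only [e.annihilator_eq, Ideal.annihilator_quotient] using
      annihilator_le (R := R) (M := R ⧸ I) (N := R) c

theorem nontrivial (h : IsCanonicalModule I c ω) (hI : I ≠ ⊤) : Nontrivial ω := by
  rwa [← not_subsingleton_iff_nontrivial, ← Module.annihilator_eq_top_iff (R := R),
    h.annihilator_eq]

theorem nontrivial_ext_quotient (h : IsCanonicalModule I c ω) (hI : I ≠ ⊤) :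
    Nontrivial (ModuleExt R (R ⧸ I) R c) := by
  obtain ⟨e⟩ := h.nonempty_ext_quotient_equiv
  exact e.toEquiv.nontrivial_congr.2 (h.nontrivial hI)

theorem idealGrade_eq (h : IsCanonicalModule I c ω) (hI : I ≠ ⊤) : idealGrade I = c :=
  moduleGrade_eq_of_nontrivial h.subsingleton_ext_quotient (h.nontrivial_ext_quotient hI)

theorem projectiveDimension_eq (h : IsCanonicalModule I c ω) (hI : I ≠ ⊤) :
    projectiveDimension (ModuleCat.of R (R ⧸ I)) = ((c : ℕ∞) : WithBot ℕ∞) :=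
  le_antisymm ((projectiveDimension_le_iff _ c).2 h.hasProjectiveDimensionLE) <|
    (projectiveDimension_ge_iff _ c).2 fun _ ↦ not_subsingleton_iff_nontrivial.2
      (h.nontrivial_ext_quotient hI) (HasProjectiveDimensionLT.subsingleton _ c c le_rfl _)

theorem isGorensteinIdeal_iff (h : IsCanonicalModule I c ω) (hI : I ≠ ⊤) :
    IsGorensteinIdeal I ↔ ∃ g : ω, span R {g} = ⊤ := by
  obtain ⟨e⟩ := h.nonempty_ext_quotient_equiv
  constructor
  · rintro ⟨c', ⟨h_grade, -⟩, ⟨e'⟩⟩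
    obtain rfl : c = c' := by
      rw [h.idealGrade_eq hI] at h_grade
      exact_mod_cast h_grade
    exact ⟨_, span_singleton_map_one_eq_top (e'.symm.trans e).toLinearMap
      (e'.symm.trans e).surjective⟩
  · rintro ⟨g, hg⟩
    refine ⟨c, ⟨h.idealGrade_eq hI, h.projectiveDimension_eq hI⟩, ⟨?_⟩⟩
    have h_ker : LinearMap.ker (LinearMap.toSpanSingleton R ω g) = I := by
      rw [← annihilator_span_singleton, hg, annihilator_top, h.annihilator_eq]
    have h_range : Function.Surjective (LinearMap.toSpanSingleton R ω g) := by
      rw [← LinearMap.range_eq_top, LinearMap.range_toSpanSingleton, hg]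
    exact e.trans <| ((quotEquivOfEq _ _ h_ker).symm.trans
      (LinearMap.quotKerEquivOfSurjective _ h_range)).symm

variable [IsNoetherianRing R]

theorem finite (h : IsCanonicalModule I c ω) : Module.Finite R ω := by
  obtain ⟨e⟩ := h.nonempty_ext_quotient_equiv
  have := ModuleCat.finite_ext R (ModuleCat.of R (R ⧸ I)) (ModuleCat.of R R) c
  exact Module.Finite.equiv e

theorem localization (h : IsCanonicalModule I c ω) (W : Submonoid R) {ω' : Type u}
    [AddCommGroup ω'] [Module R ω'] [Module (Localization W) ω']
    [IsScalarTower R (Localization W) ω'] (f : ω →ₗ[R] ω') [IsLocalizedModule W f] :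
    IsCanonicalModule (I.map (algebraMap R (Localization W))) c ω' := by
  obtain ⟨e⟩ := h.nonempty_ext_quotient_equiv
  obtain ⟨e'⟩ := h.nonempty_ext_equiv
  have := h.hasProjectiveDimensionLE
  have := h.finite
  rw [← Ideal.localized'_eq_map (Localization W) W I]
  let π := I.toLocalizedQuotient' (Localization W) W (Algebra.linearMap R (Localization W))
  refine ⟨hasProjectiveDimensionLE_of_isLocalizedModule W π c, fun i hi ↦ ?_, ?_, ?_⟩
  · have := h.subsingleton_ext_quotient i hi
    obtain ⟨e⟩ := nonempty_equiv_of_isLocalizedModule (S := Localization W) W π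
      (Algebra.linearMap R (Localization W))
      (LocalizedModule.mkLinearMap W (ModuleExt R (R ⧸ I) R i))
    exact e.symm.toEquiv.subsingleton
  · exact (nonempty_equiv_of_isLocalizedModule W π (Algebra.linearMap R (Localization W))
      (f ∘ₗ e.toLinearMap)).map LinearEquiv.symm
  · exact (nonempty_equiv_of_isLocalizedModule W f (Algebra.linearMap R (Localization W))
      (π ∘ₗ e'.toLinearMap)).map LinearEquiv.symm

theorem isGorensteinIdeal_atPrime_iff (h : IsCanonicalModule I c ω) (P : PrimeSpectrum R)
    (hP : I ≤ P.asIdeal) :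
    IsGorensteinIdeal (I.map (algebraMap R (Localization.AtPrime P.asIdeal))) ↔
      ∃ g : ω, P ∉ Module.support R (ω ⧸ span R {g}) := by
  let f := LocalizedModule.mkLinearMap P.asIdeal.primeCompl ω
  have h_ne_top : I.map (algebraMap R (Localization.AtPrime P.asIdeal)) ≠ ⊤ := by
    refine ne_top_of_le_ne_top (IsLocalRing.maximalIdeal.isMaximal _).ne_top (?_ : _ ≤ _)
    rw [← Localization.AtPrime.map_eq_maximalIdeal]
    exact Ideal.map_mono hP
  have h_iff (g : ω) : P ∉ Module.support R (ω ⧸ span R {g}) ↔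
      span (Localization.AtPrime P.asIdeal) {f g} = ⊤ :=
    notMem_support_quotient_iff.trans
      (span_singleton_localized_eq_top_iff P.asIdeal.primeCompl f g).symm
  rw [(h.localization P.asIdeal.primeCompl f).isGorensteinIdeal_iff h_ne_top]
  simp only [h_iff]
  refine ⟨?_, fun ⟨g, hg⟩ ↦ ⟨f g, hg⟩⟩
  rintro ⟨g', hg'⟩
  obtain ⟨⟨g, w⟩, rfl⟩ := IsLocalizedModule.mk'_surjective P.asIdeal.primeCompl f g'
  refine ⟨g, top_le_iff.1 (hg'.ge.trans (span_singleton_le_iff_mem _ _ |>.2 ?_))⟩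
  refine mem_span_singleton.2 ⟨IsLocalization.mk' _ 1 w, ?_⟩
  rw [← IsLocalizedModule.mk'_one P.asIdeal.primeCompl f g, IsLocalizedModule.mk'_smul_mk',
    one_smul, mul_one]
  rfl

theorem support_eq (h : IsCanonicalModule I c ω) :
    Module.support R ω = Module.support R (R ⧸ I) := by
  have := h.finite
  rw [Module.support_eq_zeroLocus, Module.support_eq_zeroLocus, h.annihilator_eq,
    Ideal.annihilator_quotient]

theorem le_moduleGrade_of_support_subset (h : IsCanonicalModule I c ω) {N : Type u}
    [AddCommGroup N] [Module R N] [Module.Finite R N]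
    (hN : Module.support R N ⊆ Module.support R ω) : (c : ℕ∞) ≤ moduleGrade R N :=
  ((le_moduleGrade_iff c).2 h.subsingleton_ext_quotient).trans
    (moduleGrade_le_of_support_subset (hN.trans h.support_eq.subset))

theorem succ_le_moduleGrade_quotient_iff (h : IsCanonicalModule I c ω) (N : Submodule R ω) :
    ((c + 1 : ℕ) : ℕ∞) ≤ moduleGrade R (ω ⧸ N) ↔ Subsingleton ((ω ⧸ N) →ₗ[R] R ⧸ I) := by
  have := h.finite
  rw [le_moduleGrade_iff]
  constructor
  · intro h_ext
    exact zeroEquiv.toEquiv.subsingleton_congr.1 <| subsingleton_of_hasProjectiveDimensionLT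
      (n := c) h.hasProjectiveDimensionLE fun i hi ↦ h_ext i (Nat.lt_succ_iff.2 hi)
  · intro h_hom i hi
    obtain ⟨r, hr, hr_reg⟩ := IsSMulRegular.subsingleton_linearMap_iff.1 h_hom
    obtain ⟨e⟩ := h.nonempty_ext_equiv
    rcases Nat.lt_succ_iff_lt_or_eq.1 hi with hi | rfl
    · exact (le_moduleGrade_iff c).1 (h.le_moduleGrade_of_support_subset
        (Module.support_subset_of_surjective _ N.mkQ_surjective)) i hi
    · have h_inj : Function.Injective (e ∘ precomp N.mkQ R i) :=
        e.injective.comp <| precomp_injective N.injective_subtype (LinearMap.exact_subtype_mkQ N)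
          N.mkQ_surjective <| (le_moduleGrade_iff i).1 <| h.le_moduleGrade_of_support_subset <|
          Module.support_subset_of_injective _ N.injective_subtype
      refine subsingleton_of_forall_eq 0 fun z ↦ h_inj (hr_reg ?_)
      simp only [Function.comp_apply, map_zero, smul_zero, ← map_smul,
        smul_eq_zero_of_mem_annihilator hr]

theorem ker_toSpanSingleton_eq (h : IsCanonicalModule I c ω) {x : ω}
    (hx : Subsingleton ((ω ⧸ span R {x}) →ₗ[R] R ⧸ I)) :
    LinearMap.ker (LinearMap.toSpanSingleton R ω x) = I := by
  have := h.finite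
  obtain ⟨r, hr, hr_reg⟩ := IsSMulRegular.subsingleton_linearMap_iff.1 hx
  rw [annihilator_quotient, mem_colon] at hr
  refine le_antisymm (fun s hs ↦ ?_) ?_
  · have hsr : s * r ∈ Module.annihilator R ω := Module.mem_annihilator.2 fun y ↦ by
      obtain ⟨t, ht⟩ := mem_span_singleton.1 (hr y (Set.mem_univ y))
      have hsx : s • x = 0 := LinearMap.mem_ker.1 hs
      rw [mul_smul, ← ht, smul_comm, hsx, smul_zero]
    rw [h.annihilator_eq, ← Ideal.Quotient.eq_zero_iff_mem, mul_comm] at hsr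
    exact Ideal.Quotient.eq_zero_iff_mem.1 (hr_reg (hsr.trans (smul_zero r).symm))
  · rw [← annihilator_span_singleton, ← h.annihilator_eq]
    exact LinearMap.annihilator_le_of_injective _ (injective_subtype _)

theorem span_singleton_eq_top_of_le_moduleGrade (h : IsCanonicalModule I c ω) {x : ω}
    (hx : ((c + 2 : ℕ) : ℕ∞) ≤ moduleGrade R (ω ⧸ span R {x})) : span R {x} = ⊤ := by
  obtain ⟨e⟩ := h.nonempty_ext_quotient_equiv
  obtain ⟨e'⟩ := h.nonempty_ext_equiv
  have h_ker := h.ker_toSpanSingleton_eq ((h.succ_le_moduleGrade_quotient_iff _).1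
    ((Nat.cast_le.2 (Nat.le_succ _)).trans hx))
  let ι : (R ⧸ I) →ₗ[R] ω := I.liftQ (LinearMap.toSpanSingleton R ω x) h_ker.ge
  have h_exact : Function.Exact ι (span R {x}).mkQ := by
    rw [LinearMap.exact_iff, ker_mkQ, range_liftQ, LinearMap.range_toSpanSingleton]
  have hι_surj : Function.Surjective (precomp ι R c) :=
    precomp_surjective (LinearMap.ker_eq_bot.1 (ker_liftQ_eq_bot _ _ _ h_ker.le)) h_exact
      (mkQ_surjective _) ((le_moduleGrade_iff _).1 hx _ (Nat.lt_succ_self _))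
  let φ : (R ⧸ I) →ₗ[R] ω := e.toLinearMap ∘ₗ precomp ι R c ∘ₗ e'.symm.toLinearMap
  have hφ : span R {φ 1} = ⊤ :=
    span_singleton_map_one_eq_top φ (e.surjective.comp (hι_surj.comp e'.symm.surjective))
  obtain ⟨r, hr⟩ := mem_span_singleton.1 (hφ.ge (mem_top (x := x)))
  have h_factor : ι = φ ∘ₗ (r • LinearMap.id) := by
    ext
    simp [ι, hr]
  -- Thus `precomp ι` is divisible by `r`, and as it is surjective, `ω = r • ω = R (r • φ 1) = R x`.
  obtain ⟨z, hz⟩ := hι_surj (e.symm (φ 1))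
  rw [h_factor, precomp_comp_apply, precomp_smul_id_apply, e.eq_symm_apply, map_smul] at hz
  obtain ⟨t, ht⟩ := mem_span_singleton.1 (hφ.ge (mem_top (x := e (precomp φ R c z))))
  refine top_le_iff.1 (hφ.ge.trans ((span_singleton_le_iff_mem _ _).2 ?_))
  exact mem_span_singleton.2 ⟨t, by rw [← hr, smul_comm, ht, hz]⟩

end IsCanonicalModule

section MinorIdeal

open Module Submodule

variable {R : Type u} [CommRing R] {k : ℕ} {A C : Type u} [AddCommGroup A] [Module R A]
  [AddCommGroup C] [Module R C]

theorem smul_mem_range_dualMap_of_mem_minorIdeal (b : Basis (Fin k) R C) (f : C →ₗ[R] A) {r : R}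
    (hr : r ∈ minorIdeal k f) (y : Dual R C) : r • y ∈ LinearMap.range f.dualMap := by
  suffices h_le : minorIdeal k f ≤
      (LinearMap.range f.dualMap).comap (LinearMap.toSpanSingleton R (Dual R C) y) from h_le hr
  rw [minorIdeal, Ideal.span_le]
  rintro _ ⟨v, φ, rfl⟩
  let K : Matrix (Fin k) (Fin k) R := Matrix.of fun i l ↦ φ i (f (b l))
  have h_mul : (Matrix.of fun i j ↦ φ i (f (v j))) = K * b.toMatrix v := by
    ext i j
    conv_lhs => rw [Matrix.of_apply, ← b.sum_repr (v j)]
    simp only [map_sum, map_smul, smul_eq_mul, Matrix.mul_apply, K, Matrix.of_apply,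
      Basis.toMatrix_apply, mul_comm]
  rw [SetLike.mem_coe, mem_comap, LinearMap.toSpanSingleton_apply, h_mul, Matrix.det_mul, mul_comm,
    mul_smul]
  -- Cramer's rule: `adj(K) K = det K` exhibits `det K • y` as the pullback of a functional.
  refine smul_mem _ _ ⟨∑ l, ∑ i, (y (b l) * K.adjugate l i) • φ i, b.ext fun m ↦ ?_⟩
  calc (∑ l, ∑ i, (y (b l) * K.adjugate l i) • φ i) (f (b m))
      = ∑ l, y (b l) * (K.adjugate * K) l m := by
        simp only [LinearMap.sum_apply, LinearMap.smul_apply, smul_eq_mul, Matrix.mul_apply,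
          Finset.mul_sum, K, Matrix.of_apply, mul_assoc]
    _ = K.det • y (b m) := by
        simp [Matrix.adjugate_mul, Matrix.one_apply, mul_comm]

theorem pow_mem_minorIdeal (b : Basis (Fin k) R C) (f : C →ₗ[R] A) {s : R}
    (hs : ∀ y : Dual R C, s • y ∈ LinearMap.range f.dualMap) : s ^ k ∈ minorIdeal k f := by
  choose φ hφ using fun i ↦ hs (b.coord i)
  refine Ideal.subset_span ⟨b, φ, ?_⟩
  have h_diag : (Matrix.of fun i j ↦ φ i (f (b j))) = s • (1 : Matrix (Fin k) (Fin k) R) := by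
    ext i j
    have := LinearMap.congr_fun (hφ i) (b j)
    simpa [Matrix.one_apply, Finsupp.single_apply, eq_comm] using this
  rw [h_diag, Matrix.det_smul, Matrix.det_one, mul_one, Fintype.card_fin]

theorem idealGrade_minorIdeal_eq [IsNoetherianRing R] (b : Basis (Fin k) R C) (f : C →ₗ[R] A) :
    idealGrade (minorIdeal k f) = moduleGrade R (Dual R C ⧸ LinearMap.range f.dualMap) := by
  have := Module.Free.of_basis b
  have := Module.Finite.of_basis b
  have h_ann (s : R) : s ∈ annihilator R (Dual R C ⧸ LinearMap.range f.dualMap) ↔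
      ∀ y : Dual R C, s • y ∈ LinearMap.range f.dualMap := by
    simp only [annihilator_quotient, mem_colon, Set.mem_univ, forall_const]
  refine moduleGrade_eq_of_support_eq ?_
  rw [support_eq_zeroLocus, support_eq_zeroLocus, Ideal.annihilator_quotient]
  refine Set.Subset.antisymm (fun P hP s hs ↦ ?_) (PrimeSpectrum.zeroLocus_anti_mono fun r hr ↦ ?_)
  · exact P.2.mem_of_pow_mem k (hP (pow_mem_minorIdeal b f ((h_ann s).1 hs)))
  · exact (h_ann r).2 (smul_mem_range_dualMap_of_mem_minorIdeal b f hr)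

end MinorIdeal

section CorankOneSummand

open Module Submodule

variable {R : Type u} [CommRing R] {k : ℕ} {A : Type u} [AddCommGroup A] [Module R A]

theorem IsCorankOneSummand.exists_ker_eq {C : Submodule R A} (h : IsCorankOneSummand k C) :
    ∃ x : Dual R A, Function.Surjective x ∧ LinearMap.ker x = C := by
  obtain ⟨L, hCL, -, ⟨e⟩⟩ := h
  refine ⟨e.toLinearMap ∘ₗ L.projectionOnto C hCL.symm,
    e.surjective.comp (projectionOnto_surjective hCL.symm), ?_⟩
  rw [LinearEquiv.ker_comp, ker_projectionOnto]

theorem isCorankOneSummand_ker [IsLocalRing R] [Module.Finite R A] [Module.Free R A]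
    (hA : finrank R A = k + 1) {x : Dual R A} (hx : Function.Surjective x) :
    IsCorankOneSummand k (LinearMap.ker x) := by
  obtain ⟨s, hs⟩ := LinearMap.exists_rightInverse_of_surjective x (LinearMap.range_eq_top.2 hx)
  have hs_inj : Function.Injective s := Function.LeftInverse.injective (LinearMap.congr_fun hs)
  have h_idem : IsIdempotentElem (s ∘ₗ x) := by
    rw [IsIdempotentElem, Module.End.mul_eq_comp, LinearMap.comp_assoc, ← LinearMap.comp_assoc x,
      hs, LinearMap.id_comp]
  have h_compl : IsCompl (LinearMap.ker x) (LinearMap.range s) := by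
    rw [← LinearMap.ker_comp_of_ker_eq_bot x (LinearMap.ker_eq_bot.2 hs_inj),
      ← LinearMap.range_comp_of_range_eq_top s (LinearMap.range_eq_top.2 hx)]
    exact (LinearMap.IsIdempotentElem.isCompl h_idem).symm
  let e : LinearMap.range s ≃ₗ[R] R := (LinearEquiv.ofInjective s hs_inj).symm
  have := Module.Projective.of_split (LinearMap.ker x).subtype
    ((LinearMap.ker x).projectionOnto _ h_compl) (by ext; simp)
  have := Module.Finite.of_surjective _ (projectionOnto_surjective h_compl)
  have : Module.Free R (LinearMap.ker x) := Module.free_of_flat_of_isLocalRing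
  have h_rank : finrank R (LinearMap.ker x) = k := by
    have := (((LinearEquiv.refl R (LinearMap.ker x)).prodCongr e.symm).trans
      (prodEquivOfIsCompl _ _ h_compl)).finrank_eq
    rw [finrank_prod, finrank_self, hA] at this
    exact Nat.succ_injective this
  exact ⟨_, h_compl, ⟨(finBasisOfFinrankEq R _ h_rank).equivFun⟩, ⟨e⟩⟩

theorem ker_dualMap_subtype_ker {x : Dual R A} (hx : Function.Surjective x) :
    LinearMap.ker (LinearMap.ker x).subtype.dualMap = span R {x} := by
  obtain ⟨u, hu⟩ := hx 1
  refine le_antisymm (fun y hy ↦ mem_span_singleton.2 ⟨y u, LinearMap.ext fun v ↦ ?_⟩) ?_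
  · have : y (v - x v • u) = 0 := LinearMap.congr_fun hy ⟨v - x v • u, by simp [hu]⟩
    rw [map_sub, map_smul, sub_eq_zero] at this
    rw [this, LinearMap.smul_apply, smul_eq_mul, smul_eq_mul, mul_comm]
  · rw [span_singleton_le_iff_mem, LinearMap.mem_ker]
    ext v
    exact v.2

theorem surjective_dualMap_subtype_ker {x : Dual R A} (hx : Function.Surjective x) :
    Function.Surjective (LinearMap.ker x).subtype.dualMap := by
  obtain ⟨u, hu⟩ := hx 1
  intro φ
  let π : A →ₗ[R] LinearMap.ker x :=
    (LinearMap.id - LinearMap.toSpanSingleton R A u ∘ₗ x).codRestrict _ fun v ↦ by simp [hu]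
  refine ⟨φ ∘ₗ π, LinearMap.ext fun v ↦ congrArg φ (Subtype.ext ?_)⟩
  simp [π]

theorem nonempty_quotient_map_equiv {R : Type*} [CommRing R] {D E ω : Type*} [AddCommGroup D]
    [Module R D] [AddCommGroup E] [Module R E] [AddCommGroup ω] [Module R ω] {ρ : D →ₗ[R] E}
    {δ : D →ₗ[R] ω} (hρ : Function.Surjective ρ) (hδ : Function.Surjective δ) :
    Nonempty ((E ⧸ (LinearMap.ker δ).map ρ) ≃ₗ[R] ω ⧸ (LinearMap.ker ρ).map δ) := by
  let e₁ := LinearMap.quotKerEquivOfSurjective (((LinearMap.ker δ).map ρ).mkQ ∘ₗ ρ)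
    ((mkQ_surjective _).comp hρ)
  let e₂ := LinearMap.quotKerEquivOfSurjective (((LinearMap.ker ρ).map δ).mkQ ∘ₗ δ)
    ((mkQ_surjective _).comp hδ)
  refine ⟨e₁.symm.trans ((quotEquivOfEq _ _ ?_).trans e₂)⟩
  rw [LinearMap.ker_comp, LinearMap.ker_comp, ker_mkQ, ker_mkQ, comap_map_eq, comap_map_eq,
    sup_comm]

theorem idealGrade_minorIdeal_comp_subtype_ker [IsNoetherianRing R] {B ω : Type u}
    [AddCommGroup B] [Module R B] [AddCommGroup ω] [Module R ω] {d : A →ₗ[R] B}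
    {δ : Dual R A →ₗ[R] ω} (hδ_surj : Function.Surjective δ) (hδ : Function.Exact d.dualMap δ)
    {x : Dual R A} (hx : Function.Surjective x) (hC : IsCorankOneSummand k (LinearMap.ker x)) :
    idealGrade (minorIdeal k (d ∘ₗ (LinearMap.ker x).subtype)) =
      moduleGrade R (ω ⧸ span R {δ x}) := by
  obtain ⟨-, -, ⟨b⟩, -⟩ := hC
  have := Module.Finite.equiv b.symm
  have := Module.Free.of_equiv b.symm
  obtain ⟨e⟩ := nonempty_quotient_map_equiv (surjective_dualMap_subtype_ker hx) hδ_surj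
  rw [ker_dualMap_subtype_ker hx, map_span, Set.image_singleton, hδ.linearMap_ker_eq,
    ← LinearMap.range_comp, LinearMap.dualMap_comp_dualMap] at e
  have := Module.Finite.equiv e
  rw [idealGrade_minorIdeal_eq (Basis.ofEquivFun b), moduleGrade_eq_of_support_eq e.support_eq]

theorem exists_isCorankOneSummand_idealGrade_iff [IsLocalRing R] [IsNoetherianRing R]
    [Module.Finite R A] [Module.Free R A] {B ω : Type u} [AddCommGroup B] [Module R B]
    [AddCommGroup ω] [Module R ω] {d : A →ₗ[R] B} {δ : Dual R A →ₗ[R] ω}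
    (hA : finrank R A = k + 1) (hδ_surj : Function.Surjective δ)
    (hδ : Function.Exact d.dualMap δ) (p : ℕ∞ → Prop) :
    (∃ C : Submodule R A, IsCorankOneSummand k C ∧
        p (idealGrade (minorIdeal k (d ∘ₗ C.subtype)))) ↔
      ∃ x : Dual R A, Function.Surjective x ∧ p (moduleGrade R (ω ⧸ span R {δ x})) := by
  constructor
  · rintro ⟨C, hC, hp⟩
    obtain ⟨x, hx, rfl⟩ := hC.exists_ker_eq
    exact ⟨x, hx, idealGrade_minorIdeal_comp_subtype_ker hδ_surj hδ hx hC ▸ hp⟩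
  · rintro ⟨x, hx, hp⟩
    have hC := isCorankOneSummand_ker hA hx
    exact ⟨_, hC, (idealGrade_minorIdeal_comp_subtype_ker hδ_surj hδ hx hC).symm ▸ hp⟩

end CorankOneSummand

section GeneralPosition

open IsLocalRing Module Submodule

theorem exists_forall_notMem_of_ne_top {R : Type*} [CommRing R] [IsLocalRing R]
    [Infinite (ResidueField R)] {M : Type*} [AddCommGroup M] [Module R M]
    {s : Set (Submodule R M)} (hs : s.Finite) (hs_top : ∀ H ∈ s, H ≠ ⊤) : ∃ x, ∀ H ∈ s, x ∉ H := by
  by_contra! h_mem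
  -- B. H. Neumann: a finite cover of a group by subgroups contains one of finite index.
  have h_cover : ⋃ H ∈ hs.toFinset, ((id H : Submodule R M) : Set M) = Set.univ :=
    Set.eq_univ_of_forall fun x ↦ by simpa using h_mem x
  obtain ⟨H, hH, hH_index⟩ := exists_finiteIndex_of_cover h_cover
  have : Finite (M ⧸ H) :=
    have : H.toAddSubgroup.FiniteIndex := hH_index
    H.toAddSubgroup.finite_quotient_of_finiteIndex
  obtain ⟨y, -, hy⟩ :=
    SetLike.exists_of_lt (lt_top_iff_ne_top.2 (hs_top H (hs.mem_toFinset.1 hH)))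
  let φ : R →ₗ[R] M ⧸ H := LinearMap.toSpanSingleton R _ (H.mkQ y)
  have h_ker : LinearMap.ker φ ≤ maximalIdeal R := by
    refine le_maximalIdeal ((Ideal.ne_top_iff_one _).2 fun h_one ↦ hy ?_)
    simpa [φ] using h_one
  have : Finite (R ⧸ LinearMap.ker φ) :=
    Finite.of_injective _ (LinearMap.ker_eq_bot.1 (ker_liftQ_eq_bot _ φ le_rfl le_rfl))
  have : Finite (ResidueField R) :=
    Finite.of_surjective _ (Ideal.Quotient.factor_surjective h_ker)
  exact not_finite (ResidueField R)

theorem exists_ne_top_forall_notMem_support_quotient_span {R : Type*} [CommRing R] {M : Type*}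
    [AddCommGroup M] [Module R M] {P : PrimeSpectrum R} (hP : P ∈ support R M) {g : M}
    (hg : P ∉ support R (M ⧸ span R {g})) :
    ∃ H : Submodule R M, H ≠ ⊤ ∧ ∀ y ∉ H, P ∉ support R (M ⧸ span R {y}) := by
  simp only [notMem_support_quotient_iff, mem_span_singleton] at hg ⊢
  -- As `g` generates `M_P`, these are the elements whose image in `M_P` lies in `P M_P`.
  let H : Submodule R M :=
    { carrier := {y | ∃ u ∉ P.asIdeal, ∃ t ∈ P.asIdeal, u • y = t • g}
      zero_mem' := ⟨1, P.2.one_notMem, 0, zero_mem _, by simp⟩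
      add_mem' := by
        rintro y y' ⟨u, hu, t, ht, h⟩ ⟨u', hu', t', ht', h'⟩
        refine ⟨u * u', P.2.mul_notMem hu hu', u' * t + u * t',
          add_mem (Ideal.mul_mem_left _ _ ht) (Ideal.mul_mem_left _ _ ht'), ?_⟩
        rw [smul_add, add_smul, mul_comm, mul_smul, h, mul_comm, mul_smul u, h', mul_smul, mul_smul]
      smul_mem' := by
        rintro a y ⟨u, hu, t, ht, h⟩
        exact ⟨u, hu, a * t, Ideal.mul_mem_left _ _ ht, by rw [smul_comm, h, mul_smul]⟩ }
  refine ⟨H, fun hH ↦ notMem_support_iff'.2 (fun y ↦ ?_) hP, fun y hy z ↦ ?_⟩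
  · obtain ⟨u, hu, t, ht, h⟩ : g ∈ H := hH ▸ mem_top
    obtain ⟨r, hr, a, ha⟩ := hg y
    refine ⟨(u - t) * r, P.2.mul_notMem (fun hut ↦ hu ?_) hr, ?_⟩
    · exact (P.asIdeal.sub_mem_iff_left ht).1 hut
    · rw [mul_smul, ← ha, smul_comm, sub_smul, h, sub_self, smul_zero]
  · obtain ⟨u, hu, t, h⟩ := hg y
    obtain ⟨r, hr, a, ha⟩ := hg z
    refine ⟨t * r, P.2.mul_notMem (fun ht ↦ hy ⟨u, hu, t, ht, h.symm⟩) hr, a * u, ?_⟩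
    rw [mul_smul, mul_smul, ← ha, ← h, smul_comm]

/-- The functionals on a module over a local ring which are not surjective. They form a submodule,
as they are the functionals with values in the maximal ideal. -/
def nonsurjectiveDual (R A : Type*) [CommRing R] [IsLocalRing R] [AddCommGroup A] [Module R A] :
    Submodule R (Dual R A) where
  carrier := {y | ∀ a, y a ∈ maximalIdeal R}
  zero_mem' _ := zero_mem _
  add_mem' hy hy' a := add_mem (hy a) (hy' a)
  smul_mem' r _ hy a := Ideal.mul_mem_left _ r (hy a)

variable {R A : Type*} [CommRing R] [IsLocalRing R] [AddCommGroup A] [Module R A]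

theorem notMem_nonsurjectiveDual_iff {y : Dual R A} :
    y ∉ nonsurjectiveDual R A ↔ Function.Surjective y := by
  rw [← LinearMap.range_eq_top, ← not_iff_not, not_not]
  refine ⟨fun hy h_top ↦ (maximalIdeal.isMaximal R).ne_top (top_le_iff.1 (h_top.ge.trans ?_)),
    fun h_ne a ↦ le_maximalIdeal h_ne ⟨a, rfl⟩⟩
  rintro _ ⟨a, rfl⟩
  exact hy a

theorem smul_mem_nonsurjectiveDual {r : R} (hr : r ∈ maximalIdeal R) (y : Dual R A) :
    r • y ∈ nonsurjectiveDual R A :=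
  fun a ↦ Ideal.mul_mem_right (y a) _ hr

variable [Module.Finite R A] [Module.Free R A]

theorem nonsurjectiveDual_ne_top (hA : finrank R A ≠ 0) : nonsurjectiveDual R A ≠ ⊤ := by
  let b := finBasis R A
  refine fun h_top ↦ (maximalIdeal.isMaximal R).ne_top ((Ideal.eq_top_iff_one _).2 ?_)
  have : b.coord ⟨0, Nat.pos_of_ne_zero hA⟩ ∈ nonsurjectiveDual R A := h_top ▸ mem_top
  simpa using this (b ⟨0, Nat.pos_of_ne_zero hA⟩)

theorem span_singleton_sup_nonsurjectiveDual_ne_top (hA : 2 ≤ finrank R A) (g : Dual R A) :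
    span R {g} ⊔ nonsurjectiveDual R A ≠ ⊤ := by
  intro h_top
  let b := finBasis R A
  have h_decomp (i : Fin (finrank R A)) :
      ∃ a : R, ∀ j, b.coord i (b j) - a * g (b j) ∈ maximalIdeal R := by
    obtain ⟨_, hy, z, hz, h_add⟩ := mem_sup.1 (h_top.ge (mem_top (x := b.coord i)))
    obtain ⟨a, rfl⟩ := mem_span_singleton.1 hy
    exact ⟨a, fun j ↦ by simpa [← h_add] using hz (b j)⟩
  let i₀ : Fin (finrank R A) := ⟨0, by omega⟩
  let i₁ : Fin (finrank R A) := ⟨1, by omega⟩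
  obtain ⟨a₀, ha₀⟩ := h_decomp i₀
  obtain ⟨a₁, ha₁⟩ := h_decomp i₁
  have h_mul : a₀ * g (b i₁) ∈ maximalIdeal R := by simpa [i₀, i₁] using ha₀ i₁
  rcases Ideal.IsPrime.mem_or_mem inferInstance h_mul with h_mem | h_mem
  · refine (maximalIdeal.isMaximal R).ne_top ((Ideal.eq_top_iff_one _).2 ?_)
    simpa using add_mem (ha₀ i₀) (Ideal.mul_mem_right (g (b i₀)) _ h_mem)
  · refine (maximalIdeal.isMaximal R).ne_top ((Ideal.eq_top_iff_one _).2 ?_)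
    simpa using add_mem (ha₁ i₁) (Ideal.mul_mem_left _ a₁ h_mem)

end GeneralPosition

theorem idealGrade_top {R : Type u} [CommRing R] : idealGrade (⊤ : Ideal R) = ⊤ :=
  ENat.eq_top_iff_forall_ge.2 fun n ↦
    (le_moduleGrade_iff n).2 fun i _ ↦ ModuleExt.subsingleton_of_subsingleton i

theorem le_of_mem_associatedPrimes_quotient {R : Type*} [CommRing R] {I P : Ideal R}
    (hP : P ∈ associatedPrimes R (R ⧸ I)) : I ≤ P := by
  simpa only [Submodule.annihilator_top, Ideal.annihilator_quotient] using
    IsAssociatedPrime.annihilator_le hP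

namespace IsCanonicalModule

open IsLocalRing Module Submodule

variable {R : Type u} [CommRing R] [IsNoetherianRing R] {I : Ideal R} {c : ℕ} {ω : Type u}
  [AddCommGroup ω] [Module R ω]

theorem isGenericallyGorenstein_iff (h : IsCanonicalModule I c ω) :
    IsGenericallyGorenstein I ↔ ∀ P : PrimeSpectrum R, P.asIdeal ∈ associatedPrimes R (R ⧸ I) →
      ∃ g : ω, P ∉ support R (ω ⧸ span R {g}) := by
  constructor
  · intro hI P hP
    exact (h.isGorensteinIdeal_atPrime_iff P (le_of_mem_associatedPrimes_quotient hP)).1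
      (hI P.asIdeal hP)
  · intro hg P hP_prime hP
    exact (h.isGorensteinIdeal_atPrime_iff ⟨P, hP_prime⟩
      (le_of_mem_associatedPrimes_quotient hP)).2 (hg ⟨P, hP_prime⟩ hP)

theorem succ_le_moduleGrade_quotient_iff_forall_notMem_support (h : IsCanonicalModule I c ω)
    (N : Submodule R ω) : ((c + 1 : ℕ) : ℕ∞) ≤ moduleGrade R (ω ⧸ N) ↔
      ∀ P : PrimeSpectrum R, P.asIdeal ∈ associatedPrimes R (R ⧸ I) → P ∉ support R (ω ⧸ N) := by
  have := h.finite
  rw [h.succ_le_moduleGrade_quotient_iff, subsingleton_linearMap_iff_forall_notMem_support]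

theorem moduleGrade_quotient_span_eq (h : IsCanonicalModule I c ω) {x : ω}
    (hx : ((c + 1 : ℕ) : ℕ∞) ≤ moduleGrade R (ω ⧸ span R {x})) (hx_top : span R {x} ≠ ⊤) :
    moduleGrade R (ω ⧸ span R {x}) = (c + 1 : ℕ) :=
  le_antisymm (ENat.lt_natCast_add_one_iff.1 <| not_le.1 <|
    mt h.span_singleton_eq_top_of_le_moduleGrade hx_top) hx

theorem exists_mem_isSMulRegular (h : IsCanonicalModule I c ω) {J : Ideal R}
    (hJ : ((c + 1 : ℕ) : ℕ∞) ≤ idealGrade J) : ∃ r ∈ J, IsSMulRegular (R ⧸ I) r := by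
  have : Subsingleton (ModuleExt R (R ⧸ J) (R ⧸ I) 0) :=
    ModuleExt.subsingleton_of_hasProjectiveDimensionLT h.hasProjectiveDimensionLE fun i hi ↦
      (le_moduleGrade_iff _).1 hJ i (Nat.lt_succ_iff.2 hi)
  simpa only [Ideal.annihilator_quotient] using IsSMulRegular.subsingleton_linearMap_iff.1
    (ModuleExt.zeroEquiv.toEquiv.subsingleton_congr.1 this)

theorem succ_le_moduleGrade_quotient_span_smul (h : IsCanonicalModule I c ω) {g : ω}
    (hg : span R {g} = ⊤) {r : R} (hr : IsSMulRegular (R ⧸ I) r) :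
    ((c + 1 : ℕ) : ℕ∞) ≤ moduleGrade R (ω ⧸ span R {r • g}) := by
  have := h.finite
  refine (h.succ_le_moduleGrade_quotient_iff _).2
    (IsSMulRegular.subsingleton_linearMap_iff.2 ⟨r, ?_, hr⟩)
  rw [annihilator_quotient, mem_colon]
  intro y _
  obtain ⟨a, rfl⟩ := mem_span_singleton.1 (hg.ge (mem_top (x := y)))
  exact mem_span_singleton.2 ⟨a, smul_comm a r g⟩

variable [IsLocalRing R]

theorem span_singleton_smul_ne_top (h : IsCanonicalModule I c ω) (hI : I ≠ ⊤) {r : R}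
    (hr : r ∈ maximalIdeal R) (g : ω) : span R {r • g} ≠ ⊤ := by
  have := h.finite
  have := h.nontrivial hI
  refine fun h_top ↦ top_ne_ideal_smul_of_le_jacobson_annihilator (R := R) (M := ω)
    (maximalIdeal_le_jacobson _) (top_le_iff.1 (h_top.ge.trans ?_)).symm
  exact (span_singleton_le_iff_mem _ _).2 (smul_mem_smul hr mem_top)

theorem exists_succ_le_moduleGrade_quotient_span [Infinite (ResidueField R)]
    (h : IsCanonicalModule I c ω) (hI : IsGenericallyGorenstein I) {D : Type*} [AddCommGroup D]
    [Module R D] {δ : D →ₗ[R] ω} (hδ : Function.Surjective δ) {H₀ : Submodule R D} (hH₀ : H₀ ≠ ⊤) :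
    ∃ x ∉ H₀, ((c + 1 : ℕ) : ℕ∞) ≤ moduleGrade R (ω ⧸ span R {δ x}) := by
  have h_supp (P : associatedPrimes R (R ⧸ I)) : ⟨P, P.2.1⟩ ∈ support R ω := by
    have := h.finite
    rw [mem_support_iff_of_finite, h.annihilator_eq]
    exact le_of_mem_associatedPrimes_quotient P.2
  have h_ex (P : associatedPrimes R (R ⧸ I)) : ∃ H : Submodule R ω, H ≠ ⊤ ∧
      ∀ y ∉ H, (⟨P, P.2.1⟩ : PrimeSpectrum R) ∉ support R (ω ⧸ span R {y}) := by
    obtain ⟨g, hg⟩ := h.isGenericallyGorenstein_iff.1 hI ⟨P, P.2.1⟩ P.2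
    exact exists_ne_top_forall_notMem_support_quotient_span (h_supp P) hg
  choose H hH_top hH using h_ex
  have : Finite (associatedPrimes R (R ⧸ I)) := associatedPrimes.finite R (R ⧸ I)
  obtain ⟨x, hx⟩ := exists_forall_notMem_of_ne_top
    (s := insert H₀ (Set.range fun P ↦ (H P).comap δ)) ((Set.finite_range _).insert H₀) <| by
      rintro _ (rfl | ⟨P, rfl⟩)
      · exact hH₀
      · exact fun h_top ↦ hH_top P (comap_injective_of_surjective hδ h_top)
  refine ⟨x, hx H₀ (Set.mem_insert _ _),
    (h.succ_le_moduleGrade_quotient_iff_forall_notMem_support _).2 fun P hP ↦ ?_⟩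
  exact hH ⟨P.asIdeal, hP⟩ (δ x) (hx _ (Set.mem_insert_of_mem _ ⟨_, rfl⟩))

variable {A : Type u} [AddCommGroup A] [Module R A] [Module.Finite R A] [Module.Free R A]
  {δ : Dual R A →ₗ[R] ω}

theorem exists_surjective_succ_le_moduleGrade_iff [Infinite (ResidueField R)]
    (h : IsCanonicalModule I c ω) (hA : finrank R A ≠ 0) (hδ : Function.Surjective δ) :
    (∃ x : Dual R A, Function.Surjective x ∧
        ((c + 1 : ℕ) : ℕ∞) ≤ moduleGrade R (ω ⧸ span R {δ x})) ↔ IsGenericallyGorenstein I := by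
  constructor
  · rintro ⟨x, -, hx⟩
    exact h.isGenericallyGorenstein_iff.2 fun P hP ↦
      ⟨δ x, (h.succ_le_moduleGrade_quotient_iff_forall_notMem_support _).1 hx P hP⟩
  · intro hI
    obtain ⟨x, hx, h_grade⟩ :=
      h.exists_succ_le_moduleGrade_quotient_span hI hδ (nonsurjectiveDual_ne_top hA)
    exact ⟨x, notMem_nonsurjectiveDual_iff.1 hx, h_grade⟩

theorem exists_surjective_moduleGrade_eq_of_isGorensteinIdeal (h : IsCanonicalModule I c ω)
    (hI : I ≠ ⊤) (hI_gor : IsGorensteinIdeal I)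
    (hR : ((c + 1 : ℕ) : ℕ∞) ≤ idealGrade (maximalIdeal R)) (hA : 2 ≤ finrank R A)
    (hδ : Function.Surjective δ) :
    ∃ x : Dual R A, Function.Surjective x ∧
      moduleGrade R (ω ⧸ span R {δ x}) = (c + 1 : ℕ) := by
  obtain ⟨r, hr, hr_reg⟩ := h.exists_mem_isSMulRegular hR
  obtain ⟨g', hg⟩ := (h.isGorensteinIdeal_iff hI).1 hI_gor
  obtain ⟨g, rfl⟩ := hδ g'
  obtain ⟨z, hz, hz_notMem⟩ : ∃ z ∈ LinearMap.ker δ, z ∉ nonsurjectiveDual R A := by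
    refine SetLike.not_le_iff_exists.1 fun h_le ↦
      span_singleton_sup_nonsurjectiveDual_ne_top hA g (top_le_iff.1 ?_)
    refine le_trans (top_le_iff.2 ?_) (sup_le_sup_left h_le _)
    rw [← comap_map_eq, map_span, Set.image_singleton, hg, comap_top]
  have h_eq : δ (z + r • g) = r • δ g := by
    rw [map_add, map_smul, LinearMap.mem_ker.1 hz, zero_add]
  refine ⟨z + r • g, notMem_nonsurjectiveDual_iff.1 ?_, ?_⟩
  · exact mt (add_mem_cancel_right (smul_mem_nonsurjectiveDual hr g)).1 hz_notMem
  · rw [h_eq]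
    exact h.moduleGrade_quotient_span_eq (h.succ_le_moduleGrade_quotient_span_smul hg hr_reg)
      (h.span_singleton_smul_ne_top hI hr _)

theorem exists_surjective_moduleGrade_eq_iff [Infinite (ResidueField R)]
    (h : IsCanonicalModule I c ω) (hI : I ≠ ⊤)
    (hR : ¬ IsGorensteinIdeal I ∨ ((c + 1 : ℕ) : ℕ∞) ≤ idealGrade (maximalIdeal R))
    (hA : 2 ≤ finrank R A) (hδ : Function.Surjective δ) :
    (∃ x : Dual R A, Function.Surjective x ∧
        moduleGrade R (ω ⧸ span R {δ x}) = (c + 1 : ℕ)) ↔ IsGenericallyGorenstein I := by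
  rw [← h.exists_surjective_succ_le_moduleGrade_iff (by omega) hδ]
  refine ⟨fun ⟨x, hx, h_eq⟩ ↦ ⟨x, hx, h_eq.ge⟩, fun ⟨x, hx, h_le⟩ ↦ ?_⟩
  by_cases hI_gor : IsGorensteinIdeal I
  · exact h.exists_surjective_moduleGrade_eq_of_isGorensteinIdeal hI hI_gor
      (hR.resolve_left (not_not.2 hI_gor)) hA hδ
  · exact ⟨x, hx, h.moduleGrade_quotient_span_eq h_le
      fun h_top ↦ hI_gor ((h.isGorensteinIdeal_iff hI).2 ⟨δ x, h_top⟩)⟩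

end IsCanonicalModule

theorem mainTheorem2_general {R : Type u} [CommRing R] [IsLocalRing R] [IsNoetherianRing R]
    [Infinite (IsLocalRing.ResidueField R)] {A₁ A₂ A₃ : Type u}
    [AddCommGroup A₁] [Module R A₁] [Module.Finite R A₁] [Module.Projective R A₁]
    [AddCommGroup A₂] [Module R A₂] [Module.Finite R A₂] [Module.Projective R A₂]
    [AddCommGroup A₃] [Module R A₃] [Module.Finite R A₃] [Module.Free R A₃]
    {d₁ : A₁ →ₗ[R] R} {d₂ : A₂ →ₗ[R] A₁} {d₃ : A₃ →ₗ[R] A₂} {I : Ideal R}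
    (hA : IsResolutionOfQuotient d₁ d₂ d₃ I) (hI : idealGrade I = 3) {k : ℕ}
    (hk : Module.finrank R A₃ = k + 1) :
    ((∃ C : Submodule R A₃, IsCorankOneSummand k C ∧
        4 ≤ idealGrade (minorIdeal k (d₃ ∘ₗ C.subtype))) ↔ IsGenericallyGorenstein I) ∧
    (1 ≤ k → (¬ IsGorensteinIdeal I ∨ 4 ≤ idealGrade (IsLocalRing.maximalIdeal R)) →
      ((∃ C : Submodule R A₃, IsCorankOneSummand k C ∧
        idealGrade (minorIdeal k (d₃ ∘ₗ C.subtype)) = 4) ↔ IsGenericallyGorenstein I)) := by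
  have h_res : IsResolutionOfLengthThree d₃ d₂ d₁ I.mkQ :=
    ⟨hA.injective_d₃, hA.exact_d₃_d₂, hA.exact_d₂_d₁,
      LinearMap.exact_iff.2 (I.ker_mkQ.trans hA.range_d₁.symm), I.mkQ_surjective⟩
  have h_can := h_res.isCanonicalModule hI.ge
  have hI_top : I ≠ ⊤ := by
    rintro rfl
    exact ENat.natCast_ne_top 3 (hI.symm.trans idealGrade_top)
  obtain ⟨δ, hδ_surj, hδ⟩ := h_res.exists_ext_three R
  refine ⟨?_, fun hk_pos hR ↦ ?_⟩
  · rw [exists_isCorankOneSummand_idealGrade_iff hk hδ_surj hδ (4 ≤ ·)]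
    exact h_can.exists_surjective_succ_le_moduleGrade_iff (by omega) hδ_surj
  · rw [exists_isCorankOneSummand_idealGrade_iff hk hδ_surj hδ (· = 4)]
    exact h_can.exists_surjective_moduleGrade_eq_iff hI_top hR (by omega) hδ_surj

theorem mainTheorem2 {R : Type u} [CommRing R] [IsLocalRing R] [IsNoetherianRing R]
    [Infinite (IsLocalRing.ResidueField R)]
    (p q : ℕ) (hp : 1 ≤ p) (hq : 3 ≤ q)
    (d₁ : (Fin (p + 2) → R) →ₗ[R] R)
    (d₂ : (Fin (p + q) → R) →ₗ[R] (Fin (p + 2) → R))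
    (d₃ : (Fin (q - 1) → R) →ₗ[R] (Fin (p + q) → R))
    (I : Ideal R) (hA : IsResolutionOfQuotient d₁ d₂ d₃ I) (hI : idealGrade I = 3) :
    ((∃ C : Submodule R (Fin (q - 1) → R), IsCorankOneSummand (q - 2) C ∧
        4 ≤ idealGrade (minorIdeal (q - 2) (d₃ ∘ₗ C.subtype))) ↔ IsGenericallyGorenstein I) ∧
    ((¬ IsGorensteinIdeal I ∨ 4 ≤ idealGrade (IsLocalRing.maximalIdeal R)) →
      ((∃ C : Submodule R (Fin (q - 1) → R), IsCorankOneSummand (q - 2) C ∧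
        idealGrade (minorIdeal (q - 2) (d₃ ∘ₗ C.subtype)) = 4) ↔ IsGenericallyGorenstein I)) :=
  (mainTheorem2_general hA hI (by rw [Module.finrank_fin_fun]; omega)).imp_right
    (· (by omega))
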